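/- Let $(A,[\,,],\rho)$ be a Lie algebroid over a smooth manifold $M$: a smooth real vector bundle $A\to M$ of finite rank, with a Lie bracket on $\Gamma(A)$ and a bundle map $\rho:A\to TM$ such that $[X,fY]=f[X,Y]+(\rho(X)\cdot f)\,Y$. For $f\in C^\infty(M)$ let $d_Af\in\Gamma(A^*)$ be $\langle d_Af,X\rangle=\rho(X)\cdot f$. For a bivector field $\pi\in\Gamma(\wedge^2A)$ let $\pi^\sharp:A^*\to A$ be $\langle\beta,\pi^\sharp\alpha\rangle=\pi(\alpha,\beta)$, let $$[\alpha,\beta]_\pi=\mathcal L_{\pi^\sharp\alpha}\beta-\mathcal L_{\pi^\sharp\beta}\alpha-d_A(\pi(\alpha,\beta)),\qquad \alpha,\beta\in\Gamma(A^*),$$ and let $d_\pi f=[\pi,f]_A=-\pi^\sharp(d_Af)\in\Gamma(A)$ for $f\in C^\infty(M)$, i.e. $\langle\alpha,d_\pi f\rangle=\rho(\pi^\sharp\alpha)\cdot f$. Let $(A,\pi,N)$ be a Poisson–Nijenhuis Lie algebroid. This means: $\pi$ is a bivector field with vanishing Schouten bracket $[\pi,\pi]_A=0$; $N:A\to A$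 is a smooth bundle map over the identity with $N[X,Y]_N=[NX,NY]$ for all $X,Y\in\Gamma(A)$, where $[X,Y]_N=[NX,Y]+[X,NY]-N[X,Y]$; and the two are compatible, i.e. $N\circ\pi^\sharp=\pi^\sharp\circ N^*$ (so that $N\pi$, defined by $(N\pi)^\sharp=N\circ\pi^\sharp$, is a bivector field) and $$[\alpha,\beta]_{N\pi}=[N^*\alpha,\beta]_\pi+[\alpha,N^*\beta]_\pi-N^*[\alpha,\beta]_\pi\qquad\text{for all }\alpha,\beta\in\Gamma(A^*).$$ Suppose that $N$ is non-degenerate, i.e. invertible in every fibre, and let $N^i\pi$ $(i\in\mathbb Z)$ be the bivector field with $(N^i\pi)^\sharp=N^i\circ\pi^\sharp$. Then the modular vector field $X_{(N,\pi)}:=d_\pi(\mathrm{Tr}\,N)\in\Gamma(A)$ is a $d_{N\pi}$-coboundary, namely $$X_{(N,\pi)}=d_{N\pi}(\ln|\det N|),$$ and it determines a hierarchy of sections $X^{k}_{(N,\pi)}\in\Gamma(A)$, $k\in\mathbb Z$, such that for all $i,j\in\mathbb Z$ $$X_{(N,\pi)}^{i+j}=N^{i+j-1}X_{(N,\pi)}=d_{N^i\pi}h_j=d_{N^j\pi}h_i,$$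 where $h_0=\ln|\det N|$ and $h_i=\frac1i\,\mathrm{Tr}\,N^i$ for $i\neq0$. -/

import Mathlib

open Bundle ContinuousLinearMap
open scoped Manifold ContDiff Topology

noncomputable section

namespace PNAlg

section General

variable {E : Type*} [NormedAddCommGroup E] [NormedSpace ℝ E]
  {M : Type*} [TopologicalSpace M] [ChartedSpace E M]

section HomBundles

variable
  {F₁ : Type*} [NormedAddCommGroup F₁] [NormedSpace ℝ F₁]
  {V₁ : M → Type*} [TopologicalSpace (TotalSpace F₁ V₁)] [∀ x, TopologicalSpace (V₁ x)]
  [∀ x, AddCommGroup (V₁ x)] [∀ x, Module ℝ (V₁ x)] [FiberBundle F₁ V₁] [VectorBundle ℝ F₁ V₁]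
  {F₂ : Type*} [NormedAddCommGroup F₂] [NormedSpace ℝ F₂]
  {V₂ : M → Type*} [TopologicalSpace (TotalSpace F₂ V₂)] [∀ x, TopologicalSpace (V₂ x)]
  [∀ x, AddCommGroup (V₂ x)] [∀ x, Module ℝ (V₂ x)] [FiberBundle F₂ V₂] [VectorBundle ℝ F₂ V₂]
  [∀ x, IsTopologicalAddGroup (V₂ x)] [∀ x, ContinuousSMul ℝ (V₂ x)]
  {F₃ : Type*} [NormedAddCommGroup F₃] [NormedSpace ℝ F₃]
  {V₃ : M → Type*} [TopologicalSpace (TotalSpace F₃ V₃)] [∀ x, TopologicalSpace (V₃ x)]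
  [∀ x, AddCommGroup (V₃ x)] [∀ x, Module ℝ (V₃ x)] [FiberBundle F₃ V₃] [VectorBundle ℝ F₃ V₃]
  [∀ x, IsTopologicalAddGroup (V₃ x)] [∀ x, ContinuousSMul ℝ (V₃ x)]

/-- Fibrewise composition of smooth bundle maps is smooth. -/
theorem contMDiff_comp_hom {φ : ∀ x, V₂ x →L[ℝ] V₃ x} {ψ : ∀ x, V₁ x →L[ℝ] V₂ x}
    (hφ : ContMDiff 𝓘(ℝ, E) (𝓘(ℝ, E).prod 𝓘(ℝ, F₂ →L[ℝ] F₃)) ∞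
      (fun x => TotalSpace.mk' (F₂ →L[ℝ] F₃) (E := fun x => V₂ x →L[ℝ] V₃ x) x (φ x)))
    (hψ : ContMDiff 𝓘(ℝ, E) (𝓘(ℝ, E).prod 𝓘(ℝ, F₁ →L[ℝ] F₂)) ∞
      (fun x => TotalSpace.mk' (F₁ →L[ℝ] F₂) (E := fun x => V₁ x →L[ℝ] V₂ x) x (ψ x))) :
    ContMDiff 𝓘(ℝ, E) (𝓘(ℝ, E).prod 𝓘(ℝ, F₁ →L[ℝ] F₃)) ∞
      (fun x => TotalSpace.mk' (F₁ →L[ℝ] F₃) (E := fun x => V₁ x →L[ℝ] V₃ x) x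
        ((φ x).comp (ψ x))) := by
  intro x₀
  have h1 := (contMDiffAt_hom_bundle _).1 (hφ x₀)
  have h2 := (contMDiffAt_hom_bundle _).1 (hψ x₀)
  refine (contMDiffAt_hom_bundle _).2 ⟨contMDiffAt_id, ?_⟩
  refine (h1.2.clm_comp h2.2).congr_of_eventuallyEq ?_
  filter_upwards [(trivializationAt F₁ V₁ x₀).open_baseSet.mem_nhds
      (FiberBundle.mem_baseSet_trivializationAt' x₀),
    (trivializationAt F₂ V₂ x₀).open_baseSet.mem_nhds
      (FiberBundle.mem_baseSet_trivializationAt' x₀),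
    (trivializationAt F₃ V₃ x₀).open_baseSet.mem_nhds
      (FiberBundle.mem_baseSet_trivializationAt' x₀)] with x a1 a2 a3
  ext v
  simp [inCoordinates_eq, a1, a2, a3]

end HomBundles

variable (E) (F : Type*) [NormedAddCommGroup F] [NormedSpace ℝ F]
  (V : M → Type*) [TopologicalSpace (TotalSpace F V)] [∀ x, TopologicalSpace (V x)]
  [∀ x, AddCommGroup (V x)] [∀ x, Module ℝ (V x)] [FiberBundle F V] [VectorBundle ℝ F V]

/-- `Γ(A)`: the smooth sections of the vector bundle `A = V` with model fibre `F`
over the manifold `M` modelled on `E`. -/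
abbrev Sec : Type _ := ContMDiffSection 𝓘(ℝ, E) F ∞ V

/-- `Γ(A*)`: the smooth sections of the dual bundle. -/
abbrev CoSec : Type _ :=
  ContMDiffSection 𝓘(ℝ, E) (F →L[ℝ] ℝ) ∞ (fun x => V x →L[ℝ] ℝ)

/-- Smooth real functions on `M`. -/
abbrev Fn (M : Type*) [TopologicalSpace M] [ChartedSpace E M] : Type _ :=
  ContMDiffMap 𝓘(ℝ, E) 𝓘(ℝ, ℝ) M ℝ ∞

variable [∀ x, IsTopologicalAddGroup (V x)] [∀ x, ContinuousSMul ℝ (V x)]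

/-- Smooth bundle maps `A → A` over the identity. -/
abbrev BundleEnd : Type _ :=
  ContMDiffSection 𝓘(ℝ, E) (F →L[ℝ] F) ∞ (fun x => V x →L[ℝ] V x)

/-- A bivector field `π ∈ 𝔛²(A) = Γ(∧² A)`, given by its bundle map `π♯ : A* → A`,
`⟨β, π♯ α⟩ = π(α, β)`: since `A` has finite rank, `π ↦ π♯` identifies the sections of `∧² A`
with the smooth bundle maps `A* → A` that are skew-symmetric. -/
structure Bivector where
  /-- The bundle map `π♯ : A* → A`. -/
  sharp : ContMDiffSection 𝓘(ℝ, E) ((F →L[ℝ] ℝ) →L[ℝ] F) ∞ (fun x => (V x →L[ℝ] ℝ) →L[ℝ] V x)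
  skew : ∀ (x : M) (α β : V x →L[ℝ] ℝ), β (sharp x α) = -α (sharp x β)


variable {E F V}

/-- The section `f Y`, for a function `f` and a section `Y`. -/
def fnSmul (f : Fn E M) (Y : Sec E F V) : Sec E F V :=
  ⟨fun x => f x • Y x, f.contMDiff.smul_section Y.contMDiff⟩

/-- The function `⟨α, X⟩`. -/
def pair (α : CoSec E F V) (X : Sec E F V) : M → ℝ := fun x => α x (X x)

namespace BundleEnd

/-- The action `X ↦ N X` on sections. -/
def apply (N : BundleEnd E F V) (X : Sec E F V) : Sec E F V :=
  ⟨fun x => N x (X x), N.contMDiff.clm_bundle_apply X.contMDiff⟩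

/-- The transpose `α ↦ N* α = α ∘ N` on sections of the dual bundle. -/
def transpose (N : BundleEnd E F V) (α : CoSec E F V) : CoSec E F V :=
  ⟨fun x => (α x).comp (N x), contMDiff_comp_hom α.contMDiff N.contMDiff⟩

/-- `N` is non-degenerate: it is invertible in every fibre. -/
def IsNondegenerate (N : BundleEnd E F V) : Prop := ∀ x, IsUnit (N x)

end BundleEnd

namespace Bivector

/-- The section `π♯ α` of `A`. -/
def sharpSec (P : Bivector E F V) (α : CoSec E F V) : Sec E F V :=
  ⟨fun x => P.sharp x (α x), P.sharp.contMDiff.clm_bundle_apply α.contMDiff⟩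

/-- The function `π(α, β) = ⟨β, π♯ α⟩`. -/
def eval (P : Bivector E F V) (α β : CoSec E F V) : M → ℝ := pair β (P.sharpSec α)

end Bivector

/-- `N ∘ π♯ = π♯ ∘ N*`; equivalently `Nπ`, with `(Nπ)♯ = N ∘ π♯`, is again skew-symmetric. -/
def SharpCommutes (P : Bivector E F V) (N : BundleEnd E F V) : Prop :=
  ∀ (x : M) (α : V x →L[ℝ] ℝ), N x (P.sharp x α) = P.sharp x (α.comp (N x))

/-- The bivector field `Nπ`, with `(Nπ)♯ = N ∘ π♯`. -/
def Bivector.twist (P : Bivector E F V) (N : BundleEnd E F V) (h : SharpCommutes P N) :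
    Bivector E F V where
  sharp := ⟨fun x => (N x).comp (P.sharp x), contMDiff_comp_hom N.contMDiff P.sharp.contMDiff⟩
  skew x α β := by
    have := P.skew x α (β.comp (N x))
    simp only [ContinuousLinearMap.comp_apply] at this
    simpa [h x β] using this

section Powers

/-- The integer power `N^i` of the fibre map at `x`, for invertible `N`. -/
def zpowFibre (N : BundleEnd E F V) (hN : N.IsNondegenerate) (i : ℤ) (x : M) : V x →L[ℝ] V x :=
  (((hN x).unit ^ i : (V x →L[ℝ] V x)ˣ) : V x →L[ℝ] V x)

theorem contMDiff_pow (φ : ∀ x, V x →L[ℝ] V x)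
    (hφ : ContMDiff 𝓘(ℝ, E) (𝓘(ℝ, E).prod 𝓘(ℝ, F →L[ℝ] F)) ∞
      (fun x => TotalSpace.mk' (F →L[ℝ] F) (E := fun x => V x →L[ℝ] V x) x (φ x))) (n : ℕ) :
    ContMDiff 𝓘(ℝ, E) (𝓘(ℝ, E).prod 𝓘(ℝ, F →L[ℝ] F)) ∞
      (fun x => TotalSpace.mk' (F →L[ℝ] F) (E := fun x => V x →L[ℝ] V x) x ((φ x) ^ (n + 1))) := by
  induction n with
  | zero => simpa using hφ
  | succ n ih =>
    have := contMDiff_comp_hom ih hφ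
    simp only [pow_succ _ (n + 1)]
    exact this

theorem contMDiff_one :
    ContMDiff 𝓘(ℝ, E) (𝓘(ℝ, E).prod 𝓘(ℝ, F →L[ℝ] F)) ∞
      (fun x => TotalSpace.mk' (F →L[ℝ] F) (E := fun x => V x →L[ℝ] V x) x
        (1 : V x →L[ℝ] V x)) := by
  intro x₀
  refine (contMDiffAt_hom_bundle _).2 ⟨contMDiffAt_id, ?_⟩
  refine (contMDiffAt_const (c := (1 : F →L[ℝ] F))).congr_of_eventuallyEq ?_
  filter_upwards [(trivializationAt F V x₀).open_baseSet.mem_nhds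
      (FiberBundle.mem_baseSet_trivializationAt' x₀)] with x a1
  ext v
  simp [inCoordinates_eq, a1]

theorem contMDiff_inv [CompleteSpace F] (N : BundleEnd E F V) (hN : N.IsNondegenerate) :
    ContMDiff 𝓘(ℝ, E) (𝓘(ℝ, E).prod 𝓘(ℝ, F →L[ℝ] F)) ∞
      (fun x => TotalSpace.mk' (F →L[ℝ] F) (E := fun x => V x →L[ℝ] V x) x
        (((hN x).unit⁻¹ : (V x →L[ℝ] V x)ˣ) : V x →L[ℝ] V x)) := by
  intro x₀
  have h1 := (contMDiffAt_hom_bundle _).1 (N.contMDiff x₀)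
  refine (contMDiffAt_hom_bundle _).2 ⟨contMDiffAt_id, ?_⟩
  have key : ∀ x ∈ (trivializationAt F V x₀).baseSet,
      ∃ u : (F →L[ℝ] F)ˣ, (u : F →L[ℝ] F) = inCoordinates F V F V x₀ x x₀ x (N x) ∧
        ((u⁻¹ : (F →L[ℝ] F)ˣ) : F →L[ℝ] F) = inCoordinates F V F V x₀ x x₀ x
          (((hN x).unit⁻¹ : (V x →L[ℝ] V x)ˣ) : V x →L[ℝ] V x) := by
    intro x a1
    have e1 : ∀ v, N x ((((hN x).unit⁻¹ : (V x →L[ℝ] V x)ˣ) : V x →L[ℝ] V x) v) = v := fun v =>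
      congrArg (fun T : V x →L[ℝ] V x => T v) (hN x).mul_val_inv
    have e2 : ∀ v, (((hN x).unit⁻¹ : (V x →L[ℝ] V x)ˣ) : V x →L[ℝ] V x) (N x v) = v := fun v =>
      congrArg (fun T : V x →L[ℝ] V x => T v) (hN x).val_inv_mul
    refine ⟨⟨inCoordinates F V F V x₀ x x₀ x (N x), inCoordinates F V F V x₀ x x₀ x
          (((hN x).unit⁻¹ : (V x →L[ℝ] V x)ˣ) : V x →L[ℝ] V x), ?_, ?_⟩, rfl, rfl⟩
    · ext v
      simp [inCoordinates_eq, a1, e1]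
    · ext v
      simp [inCoordinates_eq, a1, e2]
  obtain ⟨u₀, hu₀, -⟩ := key x₀ (FiberBundle.mem_baseSet_trivializationAt' x₀)
  have hinv : ContMDiffAt 𝓘(ℝ, F →L[ℝ] F) 𝓘(ℝ, F →L[ℝ] F) ∞ Ring.inverse
      (inCoordinates F V F V x₀ x₀ x₀ x₀ (N x₀)) := by
    rw [← hu₀]
    exact (contDiffAt_ringInverse ℝ u₀).contMDiffAt
  have h2 := ContMDiffAt.comp x₀ hinv h1.2
  refine h2.congr_of_eventuallyEq ?_
  filter_upwards [(trivializationAt F V x₀).open_baseSet.mem_nhds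
      (FiberBundle.mem_baseSet_trivializationAt' x₀)] with x a1
  obtain ⟨u, hu, hu'⟩ := key x a1
  simp only [Function.comp_apply]
  rw [← hu', ← hu, Ring.inverse_unit]

/-- The bundle map `N^i`, `i ∈ ℤ`, for non-degenerate `N`. -/
def BundleEnd.zpow [CompleteSpace F] (N : BundleEnd E F V) (hN : N.IsNondegenerate) (i : ℤ) : BundleEnd E F V where
  toFun x := zpowFibre N hN i x
  contMDiff_toFun := by
    unfold zpowFibre
    rcases i with (_ | n) | n
    · simpa using contMDiff_one
    · have := contMDiff_pow _ N.contMDiff n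
      simp only [Int.ofNat_eq_natCast, zpow_natCast, Units.val_pow_eq_pow_val, IsUnit.unit_spec]
      exact this
    · have := contMDiff_pow _ (contMDiff_inv N hN) n
      simp only [zpow_negSucc, ← inv_pow, Units.val_pow_eq_pow_val]
      exact this

theorem SharpCommutes.zpow [CompleteSpace F] {P : Bivector E F V} {N : BundleEnd E F V}
    (h : SharpCommutes P N) (hN : N.IsNondegenerate) (i : ℤ) :
    SharpCommutes P (N.zpow hN i) := by
  intro x
  have inv1 : ∀ v, N x ((((hN x).unit⁻¹ : (V x →L[ℝ] V x)ˣ) : V x →L[ℝ] V x) v) = v := fun v =>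
    congrArg (fun T : V x →L[ℝ] V x => T v) (hN x).mul_val_inv
  have inv2 : ∀ v, (((hN x).unit⁻¹ : (V x →L[ℝ] V x)ˣ) : V x →L[ℝ] V x) (N x v) = v := fun v =>
    congrArg (fun T : V x →L[ℝ] V x => T v) (hN x).val_inv_mul
  have hinv : ∀ α : V x →L[ℝ] ℝ,
      (((hN x).unit⁻¹ : (V x →L[ℝ] V x)ˣ) : V x →L[ℝ] V x) (P.sharp x α) =
        P.sharp x (α.comp (((hN x).unit⁻¹ : (V x →L[ℝ] V x)ˣ) : V x →L[ℝ] V x)) := by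
    intro α
    have := h x (α.comp (((hN x).unit⁻¹ : (V x →L[ℝ] V x)ˣ) : V x →L[ℝ] V x))
    have e : (α.comp (((hN x).unit⁻¹ : (V x →L[ℝ] V x)ˣ) : V x →L[ℝ] V x)).comp (N x) = α := by
      ext v
      simp [inv2]
    rw [e] at this
    rw [← this, inv2]
  have hpow : ∀ (T : V x →L[ℝ] V x),
      (∀ α : V x →L[ℝ] ℝ, T (P.sharp x α) = P.sharp x (α.comp T)) →
      ∀ (n : ℕ) (α : V x →L[ℝ] ℝ), (T ^ n) (P.sharp x α) = P.sharp x (α.comp (T ^ n)) := by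
    intro T hT n
    induction n with
    | zero => intro α; rfl
    | succ n ih =>
      intro α
      have e1 : (T ^ (n + 1)) (P.sharp x α) = (T ^ n) (T (P.sharp x α)) := by
        rw [pow_succ]; rfl
      have e2 : α.comp (T ^ (n + 1)) = (α.comp T).comp (T ^ n) := by
        rw [pow_succ']; rfl
      rw [e1, e2, hT, ih]
  intro α
  change (zpowFibre N hN i x) (P.sharp x α) = P.sharp x (α.comp (zpowFibre N hN i x))
  unfold zpowFibre
  rcases i with n | n
  · simp only [Int.ofNat_eq_natCast, zpow_natCast, Units.val_pow_eq_pow_val, IsUnit.unit_spec]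
    exact hpow _ (h x) n α
  · simp only [zpow_negSucc, ← inv_pow, Units.val_pow_eq_pow_val]
    exact hpow _ hinv (n + 1) α

/-- The bivector field `N^i π`, `i ∈ ℤ`. -/
def Bivector.zpowTwist [CompleteSpace F] (P : Bivector E F V) (N : BundleEnd E F V)
    (h : SharpCommutes P N) (hN : N.IsNondegenerate) (i : ℤ) : Bivector E F V :=
  P.twist (N.zpow hN i) (h.zpow hN i)

end Powers

section TraceDet

theorem trace_inCoordinates (T : ∀ x, V x →L[ℝ] V x) (x₀ x : M)
    (hx : x ∈ (trivializationAt F V x₀).baseSet) :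
    LinearMap.trace ℝ F (inCoordinates F V F V x₀ x x₀ x (T x) : F →L[ℝ] F) =
      LinearMap.trace ℝ (V x) (T x : V x →L[ℝ] V x) := by
  rw [inCoordinates_eq hx hx]
  exact LinearMap.trace_conj' (T x : V x →ₗ[ℝ] V x)
    ((trivializationAt F V x₀).continuousLinearEquivAt ℝ x hx).toLinearEquiv

theorem det_inCoordinates (T : ∀ x, V x →L[ℝ] V x) (x₀ x : M)
    (hx : x ∈ (trivializationAt F V x₀).baseSet) :
    LinearMap.det (inCoordinates F V F V x₀ x x₀ x (T x) : F →ₗ[ℝ] F) =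
      LinearMap.det (T x : V x →ₗ[ℝ] V x) := by
  rw [inCoordinates_eq hx hx]
  exact LinearMap.det_conj (T x : V x →ₗ[ℝ] V x)
    ((trivializationAt F V x₀).continuousLinearEquivAt ℝ x hx).toLinearEquiv

variable [FiniteDimensional ℝ F]

theorem contDiff_trace :
    ContDiff ℝ ∞ (fun T : F →L[ℝ] F => LinearMap.trace ℝ F (T : F →ₗ[ℝ] F)) :=
  (LinearMap.toContinuousLinearMap
    ((LinearMap.trace ℝ F).comp (ContinuousLinearMap.coeLM ℝ))).contDiff

theorem contDiff_det :
    ContDiff ℝ ∞ (fun T : F →L[ℝ] F => LinearMap.det (T : F →ₗ[ℝ] F)) := by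
  let b := Module.finBasis ℝ F
  have h : (fun T : F →L[ℝ] F => LinearMap.det (T : F →ₗ[ℝ] F)) =
      fun T => ∑ σ : Equiv.Perm (Fin (Module.finrank ℝ F)), ((Equiv.Perm.sign σ : ℤ) : ℝ) *
        ∏ i, b.repr (T (b i)) (σ i) := by
    ext T
    rw [← LinearMap.det_toMatrix b, Matrix.det_apply']
    simp [LinearMap.toMatrix_apply]
  rw [h]
  refine ContDiff.sum fun σ _ => contDiff_const.mul (contDiff_prod fun i _ => ?_)
  exact (LinearMap.toContinuousLinearMap (((b.coord (σ i)).comp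
    ((LinearMap.applyₗ (b i)).comp (ContinuousLinearMap.coeLM ℝ))))).contDiff

/-- The smooth function `Tr N`. -/
def BundleEnd.tr (N : BundleEnd E F V) : Fn E M where
  val x := LinearMap.trace ℝ (V x) (N x : V x →ₗ[ℝ] V x)
  property := by
    intro x₀
    have h1 := ((contMDiffAt_hom_bundle _).1 (N.contMDiff x₀)).2
    refine ((contDiff_trace (F := F)).contMDiff.contMDiffAt.comp x₀ h1).congr_of_eventuallyEq ?_
    filter_upwards [(trivializationAt F V x₀).open_baseSet.mem_nhds
      (FiberBundle.mem_baseSet_trivializationAt' x₀)] with x a1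
    exact (trace_inCoordinates (fun x => N x) x₀ x a1).symm

/-- The smooth function `ln |det N|`, for non-degenerate `N`. -/
def BundleEnd.logAbsDet (N : BundleEnd E F V) (hN : N.IsNondegenerate) : Fn E M where
  val x := Real.log |LinearMap.det (N x : V x →ₗ[ℝ] V x)|
  property := by
    intro x₀
    have h1 := ((contMDiffAt_hom_bundle _).1 (N.contMDiff x₀)).2
    have h2 : ContMDiffAt 𝓘(ℝ, E) 𝓘(ℝ, ℝ) ∞
        (fun x => LinearMap.det (N x : V x →ₗ[ℝ] V x)) x₀ := by
      refine ((contDiff_det (F := F)).contMDiff.contMDiffAt.comp x₀ h1).congr_of_eventuallyEq ?_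
      filter_upwards [(trivializationAt F V x₀).open_baseSet.mem_nhds
        (FiberBundle.mem_baseSet_trivializationAt' x₀)] with x a1
      exact (det_inCoordinates (fun x => N x) x₀ x a1).symm
    have h3 : LinearMap.det (N x₀ : V x₀ →ₗ[ℝ] V x₀) ≠ 0 := by
      have hu : IsUnit (N x₀ : V x₀ →ₗ[ℝ] V x₀) :=
        (hN x₀).map ContinuousLinearMap.toLinearMapRingHom
      exact (hu.map LinearMap.det).ne_zero
    simp only [Real.log_abs]
    exact (Real.contDiffAt_log.2 h3).contMDiffAt.comp x₀ h2

/-- The Hamiltonians `h_0 = ln |det N|` and `h_i = (1/i) Tr N^i` for `i ≠ 0`. -/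
def BundleEnd.hamiltonian (N : BundleEnd E F V) (hN : N.IsNondegenerate) (i : ℤ) : Fn E M :=
  if i = 0 then N.logAbsDet hN else (1 / (i : ℝ)) • (N.zpow hN i).tr

end TraceDet

end General

section Algebroid

variable {E : Type*} [NormedAddCommGroup E] [NormedSpace ℝ E]
  {M : Type*} [TopologicalSpace M] [ChartedSpace E M] [IsManifold 𝓘(ℝ, E) ∞ M]

/-- The differential of a smooth function is a smooth section of `T*M`. -/
theorem contMDiff_mfderiv (f : Fn E M) :
    ContMDiff 𝓘(ℝ, E) (𝓘(ℝ, E).prod 𝓘(ℝ, E →L[ℝ] ℝ)) ∞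
      (fun x => TotalSpace.mk' (E →L[ℝ] ℝ) (E := fun x => TangentSpace 𝓘(ℝ, E) x →L[ℝ] ℝ) x
        (mfderiv 𝓘(ℝ, E) 𝓘(ℝ, ℝ) f x)) := by
  intro x₀
  refine (contMDiffAt_hom_bundle _).2 ⟨contMDiffAt_id, ?_⟩
  have h := (f.contMDiff x₀).mfderiv_const (m := ∞) (by simp)
  refine h.congr_of_eventuallyEq ?_
  filter_upwards [(trivializationAt E (TangentSpace 𝓘(ℝ, E)) x₀).open_baseSet.mem_nhds
      (FiberBundle.mem_baseSet_trivializationAt' x₀)] with x a1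
  ext v
  simp [inTangentCoordinates, inCoordinates]
  rfl

/-- The derivative at `x` of a function `g : M → ℝ` along a tangent vector `v ∈ T_x M`. -/
def dirDeriv (g : M → ℝ) (x : M) (v : TangentSpace 𝓘(ℝ, E) x) : ℝ :=
  mfderiv 𝓘(ℝ, E) 𝓘(ℝ, ℝ) g x v

variable (E) (F : Type*) [NormedAddCommGroup F] [NormedSpace ℝ F]
  (V : M → Type*) [TopologicalSpace (TotalSpace F V)] [∀ x, TopologicalSpace (V x)]
  [∀ x, AddCommGroup (V x)] [∀ x, Module ℝ (V x)] [FiberBundle F V] [VectorBundle ℝ F V]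

/-- A Lie algebroid structure `([ , ], ρ)` on the vector bundle `A = V`: a Lie bracket on `Γ(A)`
and a smooth bundle map `ρ : A → TM` satisfying the Leibniz rule. -/
structure LieAlgebroid where
  /-- The bracket `[X, Y]` of sections. -/
  bracket : Sec E F V →ₗ[ℝ] Sec E F V →ₗ[ℝ] Sec E F V
  /-- The anchor `ρ`. -/
  anchor : ContMDiffSection 𝓘(ℝ, E) (F →L[ℝ] E) ∞ (fun x => V x →L[ℝ] TangentSpace 𝓘(ℝ, E) x)
  bracket_self : ∀ X, bracket X X = 0
  jacobi : ∀ X Y Z, bracket X (bracket Y Z) = bracket (bracket X Y) Z + bracket Y (bracket X Z)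
  leibniz : ∀ (f : Fn E M) (X Y : Sec E F V) (x : M),
    bracket X (fnSmul f Y) x =
      f x • bracket X Y x + dirDeriv f x (anchor x (X x)) • Y x

variable {E F V}

namespace LieAlgebroid

variable (A : LieAlgebroid E F V)

/-- The derivative `ρ(X)·g` of a function `g`. -/
def deriv (X : Sec E F V) (g : M → ℝ) : M → ℝ :=
  fun x => dirDeriv g x (A.anchor x (X x))

/-- The Lie algebroid differential of a function, `⟨d_A f, X⟩ = ρ(X)·f`. -/
def d (f : Fn E M) : CoSec E F V :=
  ⟨fun x => ContinuousLinearMap.comp (mfderiv 𝓘(ℝ, E) 𝓘(ℝ, ℝ) f x) (A.anchor x),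
    contMDiff_comp_hom (V₂ := fun x => TangentSpace 𝓘(ℝ, E) x) (V₃ := fun _ => ℝ)
      (contMDiff_mfderiv f) A.anchor.contMDiff⟩

/-- The Lie derivative of a one-form evaluated on a section:
`⟨L_X β, Y⟩ = ρ(X)·⟨β, Y⟩ - ⟨β, [X, Y]⟩`. -/
def lieForm (X : Sec E F V) (β : CoSec E F V) (Y : Sec E F V) : M → ℝ :=
  A.deriv X (pair β Y) - pair β (A.bracket X Y)

variable [∀ x, IsTopologicalAddGroup (V x)] [∀ x, ContinuousSMul ℝ (V x)]

/-- The deformed bracket `[X, Y]_N = [NX, Y] + [X, NY] - N[X, Y]`. -/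
def deformedBracket (N : BundleEnd E F V) (X Y : Sec E F V) : Sec E F V :=
  A.bracket (N.apply X) Y + A.bracket X (N.apply Y) - N.apply (A.bracket X Y)

/-- `N` is a Nijenhuis operator: `N[X, Y]_N - [NX, NY] = 0`. -/
def IsNijenhuis (N : BundleEnd E F V) : Prop :=
  ∀ X Y, N.apply (A.deformedBracket N X Y) - A.bracket (N.apply X) (N.apply Y) = 0

/-- The Schouten bracket `[P, Q]_A` of two bivector fields, evaluated on one-forms:
`[P, Q](α, β, γ)` is the sum over cyclic permutations of `α, β, γ` of
`⟨L_{P♯α} β, Q♯γ⟩ + ⟨L_{Q♯α} β, P♯γ⟩`. -/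
def schouten (P Q : Bivector E F V) (α β γ : CoSec E F V) : M → ℝ :=
  A.lieForm (P.sharpSec α) β (Q.sharpSec γ) + A.lieForm (Q.sharpSec α) β (P.sharpSec γ)
  + A.lieForm (P.sharpSec β) γ (Q.sharpSec α) + A.lieForm (Q.sharpSec β) γ (P.sharpSec α)
  + A.lieForm (P.sharpSec γ) α (Q.sharpSec β) + A.lieForm (Q.sharpSec γ) α (P.sharpSec β)

/-- `π` is a Poisson structure on `A`: `[π, π]_A = 0`. -/
def IsPoisson (P : Bivector E F V) : Prop := ∀ α β γ, A.schouten P P α β γ = 0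

/-- The bracket `[α, β]_π = L_{π♯α} β - L_{π♯β} α - d_A(π(α, β))` of one-forms, evaluated on a
section `Y`. -/
def formBracket (P : Bivector E F V) (α β : CoSec E F V) (Y : Sec E F V) : M → ℝ :=
  A.lieForm (P.sharpSec α) β Y - A.lieForm (P.sharpSec β) α Y - A.deriv Y (P.eval α β)

/-- The bracket `[α, β]_{N*} = [N*α, β]_π + [α, N*β]_π - N*[α, β]_π`, evaluated on a section `Y`
(recall `⟨N*ω, Y⟩ = ⟨ω, NY⟩`). -/
def deformedFormBracket (P : Bivector E F V) (N : BundleEnd E F V) (α β : CoSec E F V)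
    (Y : Sec E F V) : M → ℝ :=
  A.formBracket P (N.transpose α) β Y + A.formBracket P α (N.transpose β) Y
    - A.formBracket P α β (N.apply Y)

/-- `(A, π, N)` is a Poisson–Nijenhuis Lie algebroid: `π` is Poisson, `N` is Nijenhuis, and they
are compatible, that is, `Nπ` is a bivector field and `[ , ]_{Nπ} = [ , ]_{N*}`. -/
structure IsPoissonNijenhuis (P : Bivector E F V) (N : BundleEnd E F V) : Prop where
  isPoisson : A.IsPoisson P
  isNijenhuis : A.IsNijenhuis N
  sharpCommutes : SharpCommutes P N
  compatible : ∀ α β Y,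
    A.formBracket (P.twist N sharpCommutes) α β Y = A.deformedFormBracket P N α β Y

/-- The differential `d_π f = [π, f]_A = -π♯(d_A f)` of a function `f` in the Lie algebroid
`(A*, [ , ]_π, ρ ∘ π♯)`. -/
def poissonD (P : Bivector E F V) (f : Fn E M) : Sec E F V := -P.sharpSec (A.d f)

/-- `d_π f` is the differential of `f` for the anchor `ρ ∘ π♯`: `⟨α, d_π f⟩ = ρ(π♯α)·f`. -/
theorem pair_poissonD (P : Bivector E F V) (f : Fn E M) (α : CoSec E F V) :
    pair α (A.poissonD P f) = A.deriv (P.sharpSec α) f := by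
  ext x
  have h := P.skew x (α x) (A.d f x)
  have h2 : pair α (A.poissonD P f) x = -(α x (P.sharp x (A.d f x))) := (α x).map_neg _
  rw [h2, ← h]
  rfl

/-- The modular vector field `X_{(N,π)} = d_π(Tr N)`. -/
def modularField [FiniteDimensional ℝ F] (P : Bivector E F V) (N : BundleEnd E F V) : Sec E F V :=
  A.poissonD P N.tr

end LieAlgebroid

end Algebroid
end PNAlg

end

/-! Everything follows from the Lenard-type recursion `N* d_A h_k = d_A h_{k+1}`, valid for every
integer `k`. For a section `X`, put `L_X N = [X, N·] - N[X, ·]`, a bundle endomorphism. The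
Nijenhuis condition says exactly that `L_{NX} N = N ∘ L_X N`. The Hamiltonians are normalised so
that the derivative of `h_k`, as a function of `N`, is `V ↦ Tr(N^{k-1} V)`; for `k = 0` this is
Jacobi's formula for `ln |det N|`. Hence `ρ(NX)·h_k = Tr(N^{k-1} L_{NX} N) = Tr(N^k L_X N) =
ρ(X)·h_{k+1}`. Applying `π♯` and using `N ∘ π♯ = π♯ ∘ N*` gives `N^i d_π h_k = d_π h_{i+k}`, while
`d_{N^i π} f = N^i d_π f` by definition. Since `Tr N = h_1`, each of the three expressions in the
hierarchy equals `d_π h_{i+j}`. The computation is pointwise, in a trivialization: there `[X, ·]` is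
the derivative along `ρ(X)` plus a matrix `C` (`exists_localRep_bracket`), so `L_X N` becomes the
derivative of the matrix of `N` plus a commutator with `C`. The trace against a power of `N` kills
the commutator (`trace_zpow_of_nijenhuis`). -/

noncomputable section

/-! ### Derivatives of traces of powers. -/

namespace PNAlg

/-- The functional `v ↦ τ (a v)`. -/
def mulFunctional {R : Type*} [NormedRing R] [NormedAlgebra ℝ R] (τ : R →L[ℝ] ℝ) (a : R) :
    R →L[ℝ] ℝ :=
  τ.comp (ContinuousLinearMap.mul ℝ R a)

theorem mulFunctional_apply {R : Type*} [NormedRing R] [NormedAlgebra ℝ R] (τ : R →L[ℝ] ℝ)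
    (a v : R) : mulFunctional τ a v = τ (a * v) := rfl

/-- The derivative of `T ↦ τ (T ^ (n + 1))` for a tracial functional `τ`. -/
theorem hasFDerivAt_tracial_pow {R : Type*} [NormedRing R] [NormedAlgebra ℝ R] (τ : R →L[ℝ] ℝ)
    (hτ : ∀ a b, τ (a * b) = τ (b * a)) (n : ℕ) (a : R) :
    HasFDerivAt (fun T => τ (T ^ (n + 1)))
      (((n : ℝ) + 1) • mulFunctional τ (a ^ n)) a := by
  have h := τ.hasFDerivAt.comp a ((hasFDerivAt_id (𝕜 := ℝ) a).pow' (n + 1))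
  refine h.congr_fderiv ?_
  ext v
  -- The noncommutative power rule gives a sum of `n + 1` terms, all identified by cyclicity of `τ`.
  have : ∀ i ∈ Finset.range (n + 1), τ (a ^ (n - i) * v * a ^ i) = τ (a ^ n * v) := by
    intro i hi
    rw [hτ, ← mul_assoc, ← pow_add]
    congr 3
    have := Finset.mem_range.1 hi
    omega
  simp [mulFunctional_apply, Finset.sum_congr rfl this]

/-- Chain rule with the derivative `v ↦ -u⁻¹ v u⁻¹` of inversion; cyclicity gathers the two extra
factors `u⁻¹`, whence the exponent `n + 2`. -/
theorem hasFDerivAt_tracial_inverse_pow {R : Type*} [NormedRing R] [NormedAlgebra ℝ R]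
    [CompleteSpace R] (τ : R →L[ℝ] ℝ)
    (hτ : ∀ a b, τ (a * b) = τ (b * a)) (n : ℕ) (u : Rˣ) :
    HasFDerivAt (fun T => τ (Ring.inverse T ^ (n + 1)))
      ((-((n : ℝ) + 1)) • mulFunctional τ ((u⁻¹ : Rˣ) ^ (n + 2) : Rˣ)) u := by
  have h0 := hasFDerivAt_tracial_pow τ hτ n (Ring.inverse (u : R))
  have h := h0.comp (u : R) (hasFDerivAt_ringInverse (𝕜 := ℝ) u)
  refine h.congr_fderiv ?_
  ext v
  have : τ ((↑u⁻¹ : R) ^ n * ((↑u⁻¹ : R) * v * (↑u⁻¹ : R))) = τ ((↑u⁻¹ : R) ^ (n + 2) * v) := by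
    rw [← mul_assoc, hτ, ← mul_assoc, ← mul_assoc, ← pow_succ', ← pow_succ]
  change ((n : ℝ) + 1) * τ (Ring.inverse (u : R) ^ n * -((↑u⁻¹ : R) * v * (↑u⁻¹ : R))) =
    -((n : ℝ) + 1) * τ (((u⁻¹ ^ (n + 2) : Rˣ) : R) * v)
  rw [Ring.inverse_unit, mul_neg, map_neg, this, Units.val_pow_eq_pow_val]
  ring

variable {F : Type*} [NormedAddCommGroup F] [NormedSpace ℝ F]

/-- The integer powers of an endomorphism, with `Ring.inverse` for the inverse. -/
def endZpow (T : F →L[ℝ] F) : ℤ → F →L[ℝ] F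
  | Int.ofNat n => T ^ n
  | Int.negSucc n => Ring.inverse T ^ (n + 1)

theorem endZpow_unit (u : (F →L[ℝ] F)ˣ) (k : ℤ) :
    endZpow (u : F →L[ℝ] F) k = ((u ^ k : (F →L[ℝ] F)ˣ) : F →L[ℝ] F) := by
  rcases k with n | n
  · simp [endZpow]
  · simp [endZpow, zpow_negSucc, ← inv_pow]

/-! ### Jacobi's formula and the derivatives of the Hamiltonians. -/

section FiniteDimensional

variable [FiniteDimensional ℝ F]

variable (F) in
/-- The trace of endomorphisms as a continuous functional. -/
def traceCLM : (F →L[ℝ] F) →L[ℝ] ℝ :=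
  LinearMap.toContinuousLinearMap ((LinearMap.trace ℝ F).comp (ContinuousLinearMap.coeLM ℝ))

theorem traceCLM_apply (T : F →L[ℝ] F) : traceCLM F T = LinearMap.trace ℝ F (T : F →ₗ[ℝ] F) := rfl

theorem traceCLM_mul_comm (S T : F →L[ℝ] F) : traceCLM F (S * T) = traceCLM F (T * S) :=
  LinearMap.trace_mul_comm ℝ (S : F →ₗ[ℝ] F) (T : F →ₗ[ℝ] F)

theorem differentiable_clm_det :
    Differentiable ℝ (fun T : F →L[ℝ] F => LinearMap.det (T : F →ₗ[ℝ] F)) :=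
  contDiff_det.differentiable (by simp)

/-- Differentiability being known, the derivative is found along the lines `r ↦ 1 + r v`, where `det
(1 + r v) = 1 + r Tr v + O(r²)`. -/
theorem hasFDerivAt_det_one :
    HasFDerivAt (fun T : F →L[ℝ] F => LinearMap.det (T : F →ₗ[ℝ] F)) (traceCLM F) 1 := by
  have h := (differentiable_clm_det (F := F) 1).hasFDerivAt
  refine h.congr_fderiv ?_
  ext v
  have hline : HasDerivAt (fun r : ℝ => (1 : F →L[ℝ] F) + r • v) v 0 := by
    simpa using ((hasDerivAt_id (0 : ℝ)).smul_const v).const_add (1 : F →L[ℝ] F)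
  have h1 : HasDerivAt (fun r : ℝ => LinearMap.det (((1 : F →L[ℝ] F) + r • v : F →L[ℝ] F) :
      F →ₗ[ℝ] F)) (fderiv ℝ (fun T : F →L[ℝ] F => LinearMap.det (T : F →ₗ[ℝ] F)) 1 v) 0 := by
    exact h.comp_hasDerivAt_of_eq 0 hline (by simp)
  refine h1.unique ?_
  let b := Module.finBasis ℝ F
  set m := LinearMap.toMatrix b b (v : F →ₗ[ℝ] F)
  -- The `O(r²)` remainder is `r²` times the polynomial obtained from `p` by dropping its two lowest
  -- coefficients.
  set p := ((1 : Matrix _ _ (Polynomial ℝ)) +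
    (Polynomial.X : Polynomial ℝ) • m.map Polynomial.C).det
  have e : (fun r : ℝ => LinearMap.det (((1 : F →L[ℝ] F) + r • v : F →L[ℝ] F) : F →ₗ[ℝ] F)) =
      fun r => 1 + m.trace * r + p.divX.divX.eval r * r ^ 2 := by
    ext r
    rw [← Matrix.det_one_add_smul, ← LinearMap.det_toMatrix b]
    congr 1
    have : (((1 : F →L[ℝ] F) + r • v : F →L[ℝ] F) : F →ₗ[ℝ] F) =
      LinearMap.id + r • (v : F →ₗ[ℝ] F) := rfl
    rw [this, map_add, map_smul, LinearMap.toMatrix_id]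
  rw [e, traceCLM_apply, LinearMap.trace_eq_matrix_trace ℝ b]
  have h2 := (((hasDerivAt_id (0 : ℝ)).const_mul m.trace).const_add 1).add
    ((p.divX.divX.hasDerivAt 0).mul ((hasDerivAt_id (0 : ℝ)).pow 2))
  simp only [id_eq] at h2
  refine (h2.congr_deriv (by simp [m])).congr_of_eventuallyEq (.of_forall fun r => ?_)
  simp

/-- Writing `det T = det u · det (u⁻¹ T)` moves the base point to the identity; the logarithmic
derivative then cancels `det u`. -/
theorem hasFDerivAt_log_abs_det (u : (F →L[ℝ] F)ˣ) :
    HasFDerivAt (fun T : F →L[ℝ] F => Real.log |LinearMap.det (T : F →ₗ[ℝ] F)|)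
      (mulFunctional (traceCLM F) (u⁻¹ : (F →L[ℝ] F)ˣ)) u := by
  have hd : LinearMap.det ((u : F →L[ℝ] F) : F →ₗ[ℝ] F) ≠ 0 :=
    ((u.isUnit.map ContinuousLinearMap.toLinearMapRingHom).map LinearMap.det).ne_zero
  have e : (fun T : F →L[ℝ] F => Real.log |LinearMap.det (T : F →ₗ[ℝ] F)|) = fun T =>
      Real.log (LinearMap.det ((u : F →L[ℝ] F) : F →ₗ[ℝ] F) *
        LinearMap.det (((↑u⁻¹ : F →L[ℝ] F) * T : F →L[ℝ] F) : F →ₗ[ℝ] F)) := by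
    ext T
    rw [Real.log_abs, ← LinearMap.det_comp]
    congr 2
    ext v
    exact (congrArg (fun S : F →L[ℝ] F => S (T v)) u.mul_inv).symm
  rw [e]
  have h1 : HasFDerivAt (fun T : F →L[ℝ] F => (↑u⁻¹ : F →L[ℝ] F) * T)
      (ContinuousLinearMap.mul ℝ (F →L[ℝ] F) (u⁻¹ : (F →L[ℝ] F)ˣ)) u :=
    (ContinuousLinearMap.mul ℝ (F →L[ℝ] F) (u⁻¹ : (F →L[ℝ] F)ˣ)).hasFDerivAt
  have h2 : HasFDerivAt (fun T : F →L[ℝ] F => LinearMap.det (T : F →ₗ[ℝ] F)) (traceCLM F)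
      ((↑u⁻¹ : F →L[ℝ] F) * u) := by
    rw [u.inv_mul]; exact hasFDerivAt_det_one
  have h3 := (h2.comp (u : F →L[ℝ] F) h1).const_mul
    (LinearMap.det ((u : F →L[ℝ] F) : F →ₗ[ℝ] F))
  have one : LinearMap.det (((↑u⁻¹ : F →L[ℝ] F) * u : F →L[ℝ] F) : F →ₗ[ℝ] F) = 1 := by
    rw [u.inv_mul]; exact LinearMap.det_id
  refine (h3.log (by simpa only [Function.comp_apply, one, mul_one] using hd)).congr_fderiv ?_
  ext v
  simp only [Function.comp_apply, one, mul_one, smul_apply, smul_eq_mul]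
  field_simp
  rfl

/-- The function of an endomorphism `T` defining the Hamiltonians: `ln |det T|` for `k = 0`
and `(1/k) Tr T^k` for `k ≠ 0`. -/
def endHamiltonian (k : ℤ) (T : F →L[ℝ] F) : ℝ :=
  if k = 0 then Real.log |LinearMap.det (T : F →ₗ[ℝ] F)| else (1 / (k : ℝ)) * traceCLM F (endZpow T k)

/-- The factor `1/k` cancels the exponent, so one formula covers all `k`, with the logarithm filling
the gap at `k = 0`. -/
theorem hasFDerivAt_endHamiltonian (k : ℤ) (u : (F →L[ℝ] F)ˣ) :
    HasFDerivAt (endHamiltonian (F := F) k)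
      (mulFunctional (traceCLM F) (u ^ (k - 1) : (F →L[ℝ] F)ˣ)) u := by
  rcases k with (_ | n) | n
  · have e : endHamiltonian (F := F) (Int.ofNat 0) = fun T : F →L[ℝ] F =>
        Real.log |LinearMap.det (T : F →ₗ[ℝ] F)| := by
      ext T
      exact if_pos rfl
    have e2 : u ^ (Int.ofNat 0 - 1) = u⁻¹ := zpow_neg_one u
    rw [e, e2]
    exact hasFDerivAt_log_abs_det u
  · have h := (hasFDerivAt_tracial_pow (traceCLM F) traceCLM_mul_comm n (u : F →L[ℝ] F)).const_mul
      (1 / ((n : ℝ) + 1))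
    have e : endHamiltonian (F := F) (Int.ofNat (n + 1)) = fun T =>
        (1 / ((n : ℝ) + 1)) * traceCLM F (T ^ (n + 1)) := by
      ext T
      have : ¬ ((n : ℤ) + 1 = 0) := by omega
      simp [endHamiltonian, endZpow, this]
    rw [e]
    refine h.congr_fderiv ?_
    have : (n : ℝ) + 1 ≠ 0 := by positivity
    rw [smul_smul, one_div, inv_mul_cancel₀ this, one_smul]
    simp
  · have h := (hasFDerivAt_tracial_inverse_pow (traceCLM F) traceCLM_mul_comm n u).const_mul
      (-(1 / ((n : ℝ) + 1)))
    have e : endHamiltonian (F := F) (Int.negSucc n) = fun T =>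
        (-(1 / ((n : ℝ) + 1))) * traceCLM F (Ring.inverse T ^ (n + 1)) := by
      ext T
      have h1 : (Int.negSucc n) ≠ 0 := Int.negSucc_ne_zero n
      have h2 : (1 / ((Int.negSucc n : ℤ) : ℝ)) = -(1 / ((n : ℝ) + 1)) := by
        rw [Int.cast_negSucc, ← neg_div_neg_eq]; push_cast; rw [neg_neg, neg_div]
      rw [endHamiltonian, if_neg h1, h2]
      rfl
    rw [e]
    refine h.congr_fderiv ?_
    have : (n : ℝ) + 1 ≠ 0 := by positivity
    have e2 : u ^ (Int.negSucc n - 1) = u⁻¹ ^ (n + 2) := by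
      rw [show Int.negSucc n - 1 = Int.negSucc (n + 1) from rfl, zpow_negSucc, inv_pow]
    rw [smul_smul, neg_mul_neg, one_div, inv_mul_cancel₀ this, one_smul, e2]

end FiniteDimensional

end PNAlg
end

/-! ### Local form of the Lie algebroid bracket. -/

noncomputable section

namespace PNAlg
section Local

variable {E : Type*} [NormedAddCommGroup E] [NormedSpace ℝ E]
  {M : Type*} [TopologicalSpace M] [ChartedSpace E M] [IsManifold 𝓘(ℝ, E) ∞ M]
  {F : Type*} [NormedAddCommGroup F] [NormedSpace ℝ F]
  {V : M → Type*} [TopologicalSpace (TotalSpace F V)] [∀ x, TopologicalSpace (V x)]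
  [∀ x, AddCommGroup (V x)] [∀ x, Module ℝ (V x)] [FiberBundle F V] [VectorBundle ℝ F V]

/-- The local representative of a section in the preferred trivialization at `x₀`. -/
def localRep (x₀ : M) (Y : Sec E F V) (x : M) : F :=
  (trivializationAt F V x₀).continuousLinearMapAt ℝ x (Y x)

/-- The derivative at `x₀` of the local representative of a section along a tangent vector. -/
def localDeriv (x₀ : M) (Y : Sec E F V) (v : TangentSpace 𝓘(ℝ, E) x₀) : F :=
  mfderiv 𝓘(ℝ, E) 𝓘(ℝ, F) (localRep x₀ Y) x₀ v

omit [IsManifold 𝓘(ℝ, E) ∞ M] in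
theorem localRep_eq (x₀ : M) (Y : Sec E F V) {x : M}
    (hx : x ∈ (trivializationAt F V x₀).baseSet) :
    localRep x₀ Y x = (trivializationAt F V x₀ ⟨x, Y x⟩).2 := by
  simp [localRep, hx]

omit [IsManifold 𝓘(ℝ, E) ∞ M] in
theorem contMDiffOn_localRep [ContMDiffVectorBundle ∞ F V 𝓘(ℝ, E)] (x₀ : M) (Y : Sec E F V) :
    ContMDiffOn 𝓘(ℝ, E) 𝓘(ℝ, F) ∞ (localRep x₀ Y) (trivializationAt F V x₀).baseSet :=
  (((trivializationAt F V x₀).contMDiffOn_section_baseSet_iff).1 Y.contMDiff.contMDiffOn).congr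
    fun _ hx => localRep_eq x₀ Y hx

theorem exists_bump [FiniteDimensional ℝ E] [T2Space M] (x₀ : M) {U : Set M} (hU : U ∈ 𝓝 x₀) :
    ∃ χ : Fn E M, tsupport χ ⊆ U ∧ χ =ᶠ[𝓝 x₀] 1 := by
  obtain ⟨f, -, hf⟩ := (SmoothBumpFunction.nhds_basis_tsupport (I := 𝓘(ℝ, E)) x₀).mem_iff.1 hU
  exact ⟨⟨f, f.contMDiff⟩, hf, f.eventuallyEq_one⟩

omit [IsManifold 𝓘(ℝ, E) ∞ M] in
theorem dirDeriv_eq_zero_of_eventuallyEq_one {χ : M → ℝ} {x₀ : M} (h : χ =ᶠ[𝓝 x₀] 1)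
    (v : TangentSpace 𝓘(ℝ, E) x₀) : dirDeriv χ x₀ v = 0 := by
  have : mfderiv 𝓘(ℝ, E) 𝓘(ℝ, ℝ) χ x₀ = mfderiv 𝓘(ℝ, E) 𝓘(ℝ, ℝ) (fun _ : M => (1 : ℝ)) x₀ :=
    Filter.EventuallyEq.mfderiv_eq h
  rw [dirDeriv, this, mfderiv_const]
  rfl

/-- A local frame multiplied by a bump function, together with the corresponding coefficients of
an arbitrary section. -/
theorem exists_frame [FiniteDimensional ℝ E] [T2Space M] [ContMDiffVectorBundle ∞ F V 𝓘(ℝ, E)]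
    {ι : Type*} [Fintype ι] (b : Module.Basis ι ℝ F) (x₀ : M) :
    ∃ (χ : Fn E M) (e : ι → Sec E F V), χ =ᶠ[𝓝 x₀] 1 ∧
      (∀ i, localRep x₀ (e i) =ᶠ[𝓝 x₀] fun _ => b i) ∧
      ∀ Y : Sec E F V, ∃ c : ι → Fn E M,
        (∀ i, c i =ᶠ[𝓝 x₀] fun x => b.equivFunL (localRep x₀ Y x) i) ∧
        fnSmul χ (fnSmul χ Y) = ∑ i, fnSmul (c i) (e i) := by
  set t := trivializationAt F V x₀
  have hx₀ : x₀ ∈ t.baseSet := FiberBundle.mem_baseSet_trivializationAt' x₀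
  have hU := t.open_baseSet.mem_nhds hx₀
  obtain ⟨χ, hχ, hχ1⟩ := exists_bump (E := E) x₀ hU
  have hloc : ∀ i, ∀ x ∈ t.baseSet, t.continuousLinearMapAt ℝ x (t.localFrame b i x) = b i := by
    intro i x hx
    simp [hx, Trivialization.basisAt]
  -- One factor `χ` makes the frame global and a second one makes the coefficients global, so it is
  -- `χ² Y` that gets expanded.
  refine ⟨χ, fun i => ⟨fun x => χ x • t.localFrame b i x,
    ContMDiffOn.smul_section_of_tsupport χ.contMDiff.contMDiffOn t.open_baseSet hχ
      (t.contMDiffOn_localFrame_baseSet ∞ b i)⟩, hχ1, fun i => ?_, fun Y => ?_⟩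
  · filter_upwards [hχ1, hU] with x h1 hx
    change t.continuousLinearMapAt ℝ x (χ x • t.localFrame b i x) = b i
    rw [h1, Pi.one_apply, one_smul, hloc i x hx]
  · have hc : ∀ i, ContMDiff 𝓘(ℝ, E) 𝓘(ℝ, ℝ) ∞
        (fun x => χ x • b.equivFunL (localRep x₀ Y x) i) := by
      intro i
      refine contMDiff_of_tsupport fun x hx => ?_
      have hxU : x ∈ t.baseSet := hχ (tsupport_smul_subset_left _ _ hx)
      have h1 : ContMDiffAt 𝓘(ℝ, E) 𝓘(ℝ, F) ∞ (localRep x₀ Y) x :=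
        (contMDiffOn_localRep x₀ Y).contMDiffAt (t.open_baseSet.mem_nhds hxU)
      exact χ.contMDiff.contMDiffAt.smul
        ((((ContinuousLinearMap.proj (R := ℝ) i).comp
          (b.equivFunL : F →L[ℝ] ι → ℝ)).contMDiff).contMDiffAt.comp x h1)
    refine ⟨fun i => ⟨_, hc i⟩, fun i => ?_, ?_⟩
    · filter_upwards [hχ1] with x h1
      change χ x • b.equivFunL (localRep x₀ Y x) i = _
      rw [h1, Pi.one_apply, one_smul]
    · ext x
      have hsum : (∑ i, fnSmul (⟨_, hc i⟩ : Fn E M) (⟨fun x => χ x • t.localFrame b i x,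
          ContMDiffOn.smul_section_of_tsupport χ.contMDiff.contMDiffOn t.open_baseSet hχ
            (t.contMDiffOn_localFrame_baseSet ∞ b i)⟩ : Sec E F V)) x =
          ∑ i, (χ x • b.equivFunL (localRep x₀ Y x) i) • χ x • t.localFrame b i x := by
        rw [← ContMDiffSection.coeAddHom_apply, map_sum, Finset.sum_apply]
        rfl
      refine Eq.trans ?_ hsum.symm
      change χ x • χ x • Y x = _
      by_cases hx : x ∈ t.baseSet
      · have hY : Y x = ∑ i, b.equivFunL (localRep x₀ Y x) i • t.localFrame b i x := by
          apply (t.continuousLinearEquivAt ℝ x hx).injective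
          rw [map_sum]
          simp only [map_smul]
          have e1 : ∀ w, t.continuousLinearEquivAt ℝ x hx w = t.continuousLinearMapAt ℝ x w := by
            intro w; simp [hx]
          simp only [e1, hloc _ x hx]
          exact (b.sum_equivFun (localRep x₀ Y x)).symm
        conv_lhs => rw [hY]
        simp only [Finset.smul_sum, smul_smul]
        refine Finset.sum_congr rfl fun i _ => ?_
        congr 1
        simp only [smul_eq_mul]
        ring
      · have : χ x = 0 := image_eq_zero_of_notMem_tsupport fun h => hx (hχ h)
        simp [this]

/-- In a local trivialization, `[X, ·]` is the derivative along `ρ(X)` plus a linear term. -/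
theorem LieAlgebroid.exists_localRep_bracket [FiniteDimensional ℝ E] [T2Space M]
    [ContMDiffVectorBundle ∞ F V 𝓘(ℝ, E)] [FiniteDimensional ℝ F] (A : LieAlgebroid E F V)
    (X : Sec E F V) (x₀ : M) :
    ∃ C : F →L[ℝ] F, ∀ Y : Sec E F V,
      localRep x₀ (A.bracket X Y) x₀ = C (localRep x₀ Y x₀) +
        localDeriv x₀ Y (A.anchor x₀ (X x₀)) := by
  let b := Module.finBasis ℝ F
  obtain ⟨χ, e, hχ, he, hY⟩ := exists_frame (E := E) (V := V) b x₀
  set t := trivializationAt F V x₀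
  have hx₀ : x₀ ∈ t.baseSet := FiberBundle.mem_baseSet_trivializationAt' x₀
  set v := A.anchor x₀ (X x₀)
  have hχ1 : χ x₀ = 1 := hχ.self_of_nhds
  -- Since `χ = 1` near `x₀`, the Leibniz rule shows that multiplying by `χ` does not affect the
  -- bracket at `x₀`. Applied twice, this allows `Y` to be replaced by its frame expansion.
  have hcut : ∀ Y, A.bracket X (fnSmul χ Y) x₀ = A.bracket X Y x₀ := by
    intro Y
    rw [A.leibniz, dirDeriv_eq_zero_of_eventuallyEq_one hχ, hχ1]
    simp
  -- `C` records the brackets of `X` with the frame, the analogue of connection coefficients.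
  refine ⟨LinearMap.toContinuousLinearMap
    (b.constr ℝ fun i => localRep x₀ (A.bracket X (e i)) x₀), fun Y => ?_⟩
  obtain ⟨c, hc, hsum⟩ := hY Y
  have h1 : A.bracket X Y x₀ = ∑ i, (c i x₀ • A.bracket X (e i) x₀ + dirDeriv (c i) x₀ v • e i x₀) := by
    rw [← hcut, ← hcut, hsum, map_sum, ← ContMDiffSection.coeAddHom_apply, map_sum,
      Finset.sum_apply]
    exact Finset.sum_congr rfl fun i _ => A.leibniz _ _ _ _
  have hd : MDifferentiableAt 𝓘(ℝ, E) 𝓘(ℝ, F) (localRep x₀ Y) x₀ :=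
    ((contMDiffOn_localRep x₀ Y).contMDiffAt (t.open_baseSet.mem_nhds hx₀)).mdifferentiableAt
      (by simp)
  have h2 : ∀ i, dirDeriv (c i) x₀ v =
      b.equivFunL (localDeriv x₀ Y v) i := by
    intro i
    let p : F →L[ℝ] ℝ := (ContinuousLinearMap.proj (R := ℝ) i).comp
      (b.equivFunL : F →L[ℝ] Fin (Module.finrank ℝ F) → ℝ)
    have h3 : mfderiv 𝓘(ℝ, E) 𝓘(ℝ, ℝ) (c i) x₀ =
        mfderiv 𝓘(ℝ, E) 𝓘(ℝ, ℝ) (p ∘ localRep x₀ Y) x₀ := (hc i).mfderiv_eq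
    rw [dirDeriv, h3, mfderiv_comp x₀ ((p.contMDiff (n := 1)).mdifferentiable (by simp) _) hd]
    rw [mfderiv_eq_fderiv, p.fderiv]
    rfl
  change t.continuousLinearMapAt ℝ x₀ (A.bracket X Y x₀) = _
  rw [h1, map_sum]
  simp only [map_add, map_smul, Finset.sum_add_distrib]
  congr 1
  · rw [LinearMap.coe_toContinuousLinearMap', Module.Basis.constr_apply_fintype]
    refine Finset.sum_congr rfl fun i _ => ?_
    rw [(hc i).self_of_nhds]
    rfl
  · rw [← b.sum_equivFun (localDeriv x₀ Y v)]
    refine Finset.sum_congr rfl fun i _ => ?_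
    rw [h2]
    exact congrArg _ (he i).self_of_nhds

end Local
end PNAlg
end

/-! ### Local form of the Nijenhuis operator and trace identities. -/

noncomputable section

namespace PNAlg
section Nijenhuis

variable {E : Type*} [NormedAddCommGroup E] [NormedSpace ℝ E]
  {M : Type*} [TopologicalSpace M] [ChartedSpace E M]
  {F : Type*} [NormedAddCommGroup F] [NormedSpace ℝ F]
  {V : M → Type*} [TopologicalSpace (TotalSpace F V)] [∀ x, TopologicalSpace (V x)]
  [∀ x, AddCommGroup (V x)] [∀ x, Module ℝ (V x)] [FiberBundle F V] [VectorBundle ℝ F V]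
  [∀ x, IsTopologicalAddGroup (V x)] [∀ x, ContinuousSMul ℝ (V x)]

/-- The local representative of a bundle endomorphism in the preferred trivialization at `x₀`. -/
def endRep (x₀ : M) (N : BundleEnd E F V) (x : M) : F →L[ℝ] F :=
  inCoordinates F V F V x₀ x x₀ x (N x)

/-- The derivative of the local representative of a bundle endomorphism along a tangent vector. -/
def endDeriv (x₀ : M) (N : BundleEnd E F V) (v : TangentSpace 𝓘(ℝ, E) x₀) : F →L[ℝ] F :=
  mfderiv 𝓘(ℝ, E) 𝓘(ℝ, F →L[ℝ] F) (endRep x₀ N) x₀ v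

theorem mdifferentiableAt_endRep (x₀ : M) (N : BundleEnd E F V) :
    MDifferentiableAt 𝓘(ℝ, E) 𝓘(ℝ, F →L[ℝ] F) (endRep x₀ N) x₀ :=
  ((contMDiffAt_hom_bundle _).1 (N.contMDiff x₀)).2.mdifferentiableAt (by simp)

theorem localRep_apply (x₀ : M) (N : BundleEnd E F V) (Y : Sec E F V) {x : M}
    (hx : x ∈ (trivializationAt F V x₀).baseSet) :
    localRep x₀ (N.apply Y) x = endRep x₀ N x (localRep x₀ Y x) := by
  simp [localRep, endRep, inCoordinates_eq, hx, BundleEnd.apply]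

theorem localDeriv_apply_of_const (x₀ : M) (N : BundleEnd E F V) (Y : Sec E F V) (f : F)
    (hY : localRep x₀ Y =ᶠ[𝓝 x₀] fun _ => f) (v : TangentSpace 𝓘(ℝ, E) x₀) :
    localDeriv x₀ (N.apply Y) v = endDeriv x₀ N v f := by
  let p : (F →L[ℝ] F) →L[ℝ] F := ContinuousLinearMap.apply ℝ F f
  have h : localRep x₀ (N.apply Y) =ᶠ[𝓝 x₀] p ∘ endRep x₀ N := by
    filter_upwards [hY, (trivializationAt F V x₀).open_baseSet.mem_nhds
      (FiberBundle.mem_baseSet_trivializationAt' x₀)] with x h1 hx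
    rw [localRep_apply x₀ N Y hx, h1]
    rfl
  rw [localDeriv, h.mfderiv_eq, mfderiv_comp x₀ ((p.contMDiff (n := 1)).mdifferentiable (by simp) _)
    (mdifferentiableAt_endRep x₀ N), mfderiv_eq_fderiv, p.fderiv]
  rfl

omit [∀ x, IsTopologicalAddGroup (V x)] [∀ x, ContinuousSMul ℝ (V x)] in
theorem localDeriv_of_const (x₀ : M) (Y : Sec E F V) (f : F)
    (hY : localRep x₀ Y =ᶠ[𝓝 x₀] fun _ => f) (v : TangentSpace 𝓘(ℝ, E) x₀) :
    localDeriv x₀ Y v = 0 := by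
  rw [localDeriv, hY.mfderiv_eq, mfderiv_const]
  rfl

/-- Reading a fibre endomorphism in a trivialization is conjugation, an algebra isomorphism, hence
compatible with integer powers of units. -/
theorem exists_unit_endRep [CompleteSpace F] (N : BundleEnd E F V) (hN : N.IsNondegenerate)
    (x₀ : M) {x : M} (hx : x ∈ (trivializationAt F V x₀).baseSet) :
    ∃ u : (F →L[ℝ] F)ˣ, (u : F →L[ℝ] F) = endRep x₀ N x ∧
      ∀ k : ℤ, ((u ^ k : (F →L[ℝ] F)ˣ) : F →L[ℝ] F) = endRep x₀ (N.zpow hN k) x := by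
  let e := ((trivializationAt F V x₀).continuousLinearEquivAt ℝ x hx).conjContinuousAlgEquiv
  have he : ∀ T : BundleEnd E F V, endRep x₀ T x = e (T x) := fun T => inCoordinates_eq hx hx
  refine ⟨Units.map (e : (V x →L[ℝ] V x) →* (F →L[ℝ] F)) (hN x).unit, (he N).symm, fun k => ?_⟩
  rw [he, ← map_zpow]
  rfl

variable [FiniteDimensional ℝ F]

theorem hamiltonian_eq_endHamiltonian (N : BundleEnd E F V) (hN : N.IsNondegenerate) (k : ℤ)
    (x₀ : M) {x : M} (hx : x ∈ (trivializationAt F V x₀).baseSet) :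
    N.hamiltonian hN k x = endHamiltonian k (endRep x₀ N x) := by
  obtain ⟨u, hu, hk⟩ := exists_unit_endRep N hN x₀ hx
  by_cases h0 : k = 0
  · rw [BundleEnd.hamiltonian, endHamiltonian, if_pos h0, if_pos h0]
    exact congrArg (fun r => Real.log |r|) (det_inCoordinates (fun x => N x) x₀ x hx).symm
  · rw [BundleEnd.hamiltonian, endHamiltonian, if_neg h0, if_neg h0, ← hu, endZpow_unit, hk]
    exact congrArg (fun r => 1 / (k : ℝ) * r)
      (trace_inCoordinates (fun x => N.zpow hN k x) x₀ x hx).symm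

theorem BundleEnd.hamiltonian_one (N : BundleEnd E F V) (hN : N.IsNondegenerate) :
    N.hamiltonian hN 1 = N.tr := by
  have h1 : N.zpow hN 1 = N := by
    ext x : 1
    change (((hN x).unit ^ (1 : ℤ) : (V x →L[ℝ] V x)ˣ) : V x →L[ℝ] V x) = N x
    rw [zpow_one, IsUnit.unit_spec]
  rw [BundleEnd.hamiltonian, if_neg one_ne_zero, h1]
  simp

theorem dirDeriv_hamiltonian (N : BundleEnd E F V) (hN : N.IsNondegenerate) (k : ℤ) (x₀ : M)
    (v : TangentSpace 𝓘(ℝ, E) x₀) (u : (F →L[ℝ] F)ˣ) (hu : (u : F →L[ℝ] F) = endRep x₀ N x₀) :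
    dirDeriv (N.hamiltonian hN k) x₀ v =
      traceCLM F ((u ^ (k - 1) : (F →L[ℝ] F)ˣ) * endDeriv x₀ N v) := by
  have h : (N.hamiltonian hN k : M → ℝ) =ᶠ[𝓝 x₀] endHamiltonian k ∘ endRep x₀ N := by
    filter_upwards [(trivializationAt F V x₀).open_baseSet.mem_nhds
      (FiberBundle.mem_baseSet_trivializationAt' x₀)] with x hx
    exact hamiltonian_eq_endHamiltonian N hN k x₀ hx
  have hd := hasFDerivAt_endHamiltonian (F := F) k u
  rw [hu] at hd
  rw [dirDeriv, h.mfderiv_eq, mfderiv_comp x₀ hd.differentiableAt.mdifferentiableAt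
    (mdifferentiableAt_endRep x₀ N), mfderiv_eq_fderiv, hd.fderiv]
  rfl

/-- The hypothesis is `L_{NX} N = N ∘ L_X N` in matrices. Multiplied by `u^{k-1}` and traced, it
loses both commutators, because `u` commutes with its powers. -/
theorem trace_zpow_of_nijenhuis (u : (F →L[ℝ] F)ˣ) (k : ℤ) {D D' C C' : F →L[ℝ] F}
    (h : D' + C' * u - u * C' = u * (D + C * u - u * C)) :
    traceCLM F ((u ^ (k - 1) : (F →L[ℝ] F)ˣ) * D') =
      traceCLM F ((u ^ k : (F →L[ℝ] F)ˣ) * D) := by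
  have e1 : ((u ^ (k - 1) : (F →L[ℝ] F)ˣ) : F →L[ℝ] F) * u = (u ^ k : (F →L[ℝ] F)ˣ) := by
    rw [← Units.val_mul, ← zpow_add_one, sub_add_cancel]
  have hcomm : ∀ (j : ℤ) (S : F →L[ℝ] F),
      traceCLM F ((u ^ j : (F →L[ℝ] F)ˣ) * (S * u - u * S)) = 0 := by
    intro j S
    rw [mul_sub, map_sub, ← mul_assoc, traceCLM_mul_comm _ (u : F →L[ℝ] F), ← mul_assoc,
      ← mul_assoc, ← Units.val_mul, ← Units.val_mul, ← zpow_one_add, ← zpow_add_one, add_comm,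
      sub_self]
  have h' : D' + (C' * u - u * C') = u * (D + (C * u - u * C)) := by
    rw [← add_sub_assoc, ← add_sub_assoc, h]
  have h2 := congrArg (fun T => traceCLM F ((u ^ (k - 1) : (F →L[ℝ] F)ˣ) * T)) h'
  rwa [mul_add, map_add, hcomm, add_zero, ← mul_assoc, e1, mul_add, map_add, hcomm,
    add_zero] at h2

end Nijenhuis

/-! ### The recursion for the Hamiltonians and the hierarchy. -/

section Hierarchy

variable {E : Type*} [NormedAddCommGroup E] [NormedSpace ℝ E] [FiniteDimensional ℝ E]
  {M : Type*} [TopologicalSpace M] [ChartedSpace E M] [IsManifold 𝓘(ℝ, E) ∞ M] [T2Space M]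
  {F : Type*} [NormedAddCommGroup F] [NormedSpace ℝ F] [FiniteDimensional ℝ F]
  {V : M → Type*} [TopologicalSpace (TotalSpace F V)] [∀ x, TopologicalSpace (V x)]
  [∀ x, AddCommGroup (V x)] [∀ x, Module ℝ (V x)] [FiberBundle F V] [VectorBundle ℝ F V]
  [ContMDiffVectorBundle ∞ F V 𝓘(ℝ, E)]

/-- The Nijenhuis condition concerns global sections; this lets it test covectors at a single point.
-/
theorem exists_section_apply_eq (x₀ : M) (w : V x₀) : ∃ X : Sec E F V, X x₀ = w := by
  let b := Module.finBasis ℝ F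
  obtain ⟨-, e, -, he, -⟩ := exists_frame (E := E) (V := V) b x₀
  set t := trivializationAt F V x₀
  have hx₀ : x₀ ∈ t.baseSet := FiberBundle.mem_baseSet_trivializationAt' x₀
  refine ⟨∑ i, b.repr (t.continuousLinearMapAt ℝ x₀ w) i • e i, ?_⟩
  apply (t.continuousLinearEquivAt ℝ x₀ hx₀).injective
  have e1 : ∀ w, t.continuousLinearEquivAt ℝ x₀ hx₀ w = t.continuousLinearMapAt ℝ x₀ w := by
    intro w; simp [hx₀]
  rw [e1, e1, ← ContMDiffSection.coeAddHom_apply, map_sum, Finset.sum_apply, map_sum]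
  conv_rhs => rw [← b.sum_repr (t.continuousLinearMapAt ℝ x₀ w)]
  refine Finset.sum_congr rfl fun i _ => ?_
  rw [ContMDiffSection.coeAddHom_apply, ContMDiffSection.coe_smul, Pi.smul_apply, map_smul]
  exact congrArg _ (he i).self_of_nhds

variable [∀ x, IsTopologicalAddGroup (V x)] [∀ x, ContinuousSMul ℝ (V x)]

/-- The identity `L_{NX} N = N ∘ L_X N` for a Nijenhuis operator, in a local trivialization. -/
theorem LieAlgebroid.IsNijenhuis.exists_endDeriv_eq {A : LieAlgebroid E F V}
    {N : BundleEnd E F V} (h : A.IsNijenhuis N) (X : Sec E F V) (x₀ : M) :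
    ∃ C C' : F →L[ℝ] F,
      endDeriv x₀ N (A.anchor x₀ (N x₀ (X x₀))) + C' * endRep x₀ N x₀ - endRep x₀ N x₀ * C' =
        endRep x₀ N x₀ *
          (endDeriv x₀ N (A.anchor x₀ (X x₀)) + C * endRep x₀ N x₀ - endRep x₀ N x₀ * C) := by
  let b := Module.finBasis ℝ F
  obtain ⟨-, e, -, he, -⟩ := exists_frame (E := E) (V := V) b x₀
  obtain ⟨C, hC⟩ := A.exists_localRep_bracket X x₀
  obtain ⟨C', hC'⟩ := A.exists_localRep_bracket (N.apply X) x₀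
  have hx₀ : x₀ ∈ (trivializationAt F V x₀).baseSet := FiberBundle.mem_baseSet_trivializationAt' x₀
  -- The Nijenhuis condition is tested on frame sections `e j`. They are constant near `x₀` in the
  -- trivialization, so only derivatives of `N` survive.
  refine ⟨C, C', ContinuousLinearMap.coe_injective (b.ext fun j => ?_)⟩
  have hj := sub_eq_zero.1 (h X (e j))
  have hj' := congrArg (fun Y => localRep x₀ Y x₀) hj
  have hadd : ∀ Y Z : Sec E F V, localRep x₀ (Y + Z) x₀ = localRep x₀ Y x₀ + localRep x₀ Z x₀ :=
    fun Y Z => map_add _ _ _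
  have hsub : ∀ Y Z : Sec E F V, localRep x₀ (Y - Z) x₀ = localRep x₀ Y x₀ - localRep x₀ Z x₀ :=
    fun Y Z => map_sub _ _ _
  have hconst := (he j).self_of_nhds
  simp only [LieAlgebroid.deformedBracket, localRep_apply _ _ _ hx₀, hsub, hadd, hC, hC',
    localDeriv_apply_of_const x₀ N _ _ (he j), localDeriv_of_const x₀ _ _ (he j), hconst,
    add_zero] at hj'
  change endDeriv x₀ N (A.anchor x₀ (N x₀ (X x₀))) (b j) + C' (endRep x₀ N x₀ (b j)) -
    endRep x₀ N x₀ (C' (b j)) = endRep x₀ N x₀ (endDeriv x₀ N (A.anchor x₀ (X x₀)) (b j) +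
      C (endRep x₀ N x₀ (b j)) - endRep x₀ N x₀ (C (b j)))
  have ha : (N.apply X) x₀ = N x₀ (X x₀) := rfl
  rw [ha] at hj'
  simp only [map_add, map_sub] at hj' ⊢
  rw [add_comm (endDeriv x₀ N (A.anchor x₀ (N x₀ (X x₀))) (b j)), ← hj']
  abel

/-- The recursion `N* d_A h_k = d_A h_{k+1}`: both sides are traces of a power of `N` against a
derivative of `N`, matched by the Nijenhuis identity. -/
theorem LieAlgebroid.IsNijenhuis.d_hamiltonian_comp {A : LieAlgebroid E F V}
    {N : BundleEnd E F V} (h : A.IsNijenhuis N) (hN : N.IsNondegenerate) (k : ℤ) (x : M) :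
    (A.d (N.hamiltonian hN k) x).comp (N x) = A.d (N.hamiltonian hN (k + 1)) x := by
  ext w
  obtain ⟨X, rfl⟩ := exists_section_apply_eq (E := E) (F := F) x w
  obtain ⟨u, hu, -⟩ := exists_unit_endRep N hN x (FiberBundle.mem_baseSet_trivializationAt' x)
  obtain ⟨C, C', hC⟩ := h.exists_endDeriv_eq X x
  rw [← hu] at hC
  have h1 := trace_zpow_of_nijenhuis u k hC
  change dirDeriv (N.hamiltonian hN k) x (A.anchor x (N x (X x))) =
    dirDeriv (N.hamiltonian hN (k + 1)) x (A.anchor x (X x))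
  rw [dirDeriv_hamiltonian N hN _ x _ u hu, dirDeriv_hamiltonian N hN _ x _ u hu,
    add_sub_cancel_right]
  exact h1

theorem LieAlgebroid.IsNijenhuis.d_hamiltonian_comp_zpow {A : LieAlgebroid E F V}
    {N : BundleEnd E F V} (h : A.IsNijenhuis N) (hN : N.IsNondegenerate) (i k : ℤ) (x : M) :
    (A.d (N.hamiltonian hN k) x).comp (N.zpow hN i x) = A.d (N.hamiltonian hN (i + k)) x := by
  have hz : ∀ j : ℤ, N.zpow hN j x = (((hN x).unit ^ j : (V x →L[ℝ] V x)ˣ) : V x →L[ℝ] V x) :=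
    fun _ => rfl
  -- One factor `N` is traded for a unit shift of the Hamiltonian. Read backwards, this also serves
  -- negative powers.
  have step : ∀ j k : ℤ, (A.d (N.hamiltonian hN k) x).comp (N.zpow hN (j + 1) x) =
      (A.d (N.hamiltonian hN (k + 1)) x).comp (N.zpow hN j x) := by
    intro j k
    rw [← h.d_hamiltonian_comp, hz, hz, add_comm, zpow_one_add, Units.val_mul]
    rfl
  induction i generalizing k with
  | zero =>
    rw [zero_add, hz, zpow_zero]
    rfl
  | succ n ih => rw [step, ih, add_assoc, add_comm k, ← add_assoc]
  | pred n ih =>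
    have := step (-(n : ℤ) - 1) (k - 1)
    rw [sub_add_cancel, sub_add_cancel, ih] at this
    rw [← this]
    congr 3
    ring

/-- `N^i ∘ d_π h_k = d_π h_{i+k}`. -/
theorem LieAlgebroid.IsNijenhuis.zpow_apply_poissonD {A : LieAlgebroid E F V}
    {N : BundleEnd E F V} (h : A.IsNijenhuis N) (hN : N.IsNondegenerate) {P : Bivector E F V}
    (hP : SharpCommutes P N) (i k : ℤ) :
    (N.zpow hN i).apply (A.poissonD P (N.hamiltonian hN k)) =
      A.poissonD P (N.hamiltonian hN (i + k)) := by
  ext x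
  change N.zpow hN i x (-(P.sharp x (A.d (N.hamiltonian hN k) x))) =
    -(P.sharp x (A.d (N.hamiltonian hN (i + k)) x))
  rw [map_neg, hP.zpow hN i x, h.d_hamiltonian_comp_zpow]

omit [FiniteDimensional ℝ E] [T2Space M] [ContMDiffVectorBundle ∞ F V 𝓘(ℝ, E)] in
theorem LieAlgebroid.poissonD_zpowTwist (A : LieAlgebroid E F V) {N : BundleEnd E F V}
    (hN : N.IsNondegenerate) {P : Bivector E F V} (hP : SharpCommutes P N) (i : ℤ) (f : Fn E M) :
    A.poissonD (P.zpowTwist N hP hN i) f = (N.zpow hN i).apply (A.poissonD P f) := by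
  ext x
  exact (map_neg (N.zpow hN i x) _).symm

end Hierarchy
end PNAlg

end

theorem mainTheorem1
    {E : Type*} [NormedAddCommGroup E] [NormedSpace ℝ E] [FiniteDimensional ℝ E]
    {M : Type*} [TopologicalSpace M] [ChartedSpace E M] [IsManifold 𝓘(ℝ, E) ∞ M]
    [T2Space M] [SecondCountableTopology M]
    {F : Type*} [NormedAddCommGroup F] [NormedSpace ℝ F] [FiniteDimensional ℝ F]
    {V : M → Type*} [TopologicalSpace (TotalSpace F V)] [∀ x, TopologicalSpace (V x)]
    [∀ x, AddCommGroup (V x)] [∀ x, Module ℝ (V x)]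
    [∀ x, IsTopologicalAddGroup (V x)] [∀ x, ContinuousSMul ℝ (V x)]
    [FiberBundle F V] [VectorBundle ℝ F V] [ContMDiffVectorBundle ∞ F V 𝓘(ℝ, E)]
    (A : PNAlg.LieAlgebroid E F V) (P : PNAlg.Bivector E F V) (N : PNAlg.BundleEnd E F V)
    (hPN : A.IsPoissonNijenhuis P N) (hN : N.IsNondegenerate) :
    A.modularField P N = A.poissonD (P.twist N hPN.sharpCommutes) (N.logAbsDet hN) ∧
    ∃ X : ℤ → PNAlg.Sec E F V, ∀ i j : ℤ,
      X (i + j) = (N.zpow hN (i + j - 1)).apply (A.modularField P N) ∧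
      X (i + j) = A.poissonD (P.zpowTwist N hPN.sharpCommutes hN i) (N.hamiltonian hN j) ∧
      X (i + j) = A.poissonD (P.zpowTwist N hPN.sharpCommutes hN j) (N.hamiltonian hN i) := by
  have hNij := hPN.isNijenhuis
  have hP := hPN.sharpCommutes
  have hmod : A.modularField P N = A.poissonD P (N.hamiltonian hN 1) := by
    rw [N.hamiltonian_one hN]
    rfl
  have hX : ∀ i j : ℤ, (N.zpow hN (i + j - 1)).apply (A.modularField P N) =
      A.poissonD (P.zpowTwist N hP hN i) (N.hamiltonian hN j) := by
    intro i j
    rw [hmod, hNij.zpow_apply_poissonD hN hP, A.poissonD_zpowTwist, hNij.zpow_apply_poissonD hN hP,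
      sub_add_cancel]
  -- The exponent is `m - 1` because the modular field is `d_π h_1`; thus `X m = d_π h_m`.
  refine ⟨?_, fun m => (N.zpow hN (m - 1)).apply (A.modularField P N), fun i j =>
    ⟨rfl, hX i j, ?_⟩⟩
  -- The coboundary claim is the recursion at `k = 0`, pushed through `π♯`.
  · have h0 : N.logAbsDet hN = N.hamiltonian hN 0 := (if_pos rfl).symm
    rw [hmod, h0]
    ext x
    change -(P.sharp x (A.d (N.hamiltonian hN 1) x)) =
      -(N x (P.sharp x (A.d (N.hamiltonian hN 0) x)))
    rw [hP x, hNij.d_hamiltonian_comp hN, zero_add]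
  · rw [add_comm]
    exact hX j i
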